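/- Let $u_0:\mathbb R\to\mathbb R$ be a non-constant periodic solution, with least positive period $\tau_0$, of the equation $$u''+[u^2+(u+u')^2-1]\,u'+u=0,\qquad\text{i.e.}\qquad u''+u'^3+2uu'^2+(2u^2-1)u'+u=0,$$ with $u_0(0)=a<0$ and $u_0'(0)=0$. Put $x=(x_1,x_2)=(u',u)$, write the equation as the plane system $x'=f(x)$ with $$f(x_1,x_2)=\bigl(-[x_2^2+(x_2+x_1)^2-1]x_1-x_2,\;x_1\bigr),$$ and let $q=(u_0',u_0)$. Let $\Phi$ be the fundamental matrix of the variational system $y'=f'(q(t))\,y$ with $\Phi(0)=I$, and suppose that $1$ is a simple characteristic multiplier, i.e. an eigenvalue of $\Phi(\tau_0)$ of algebraic multiplicity one. Let $\omega:\mathbb R^3\to\mathbb R$, $(s,u,v)\mapsto\omega(s,u,v)$, be of class $C^1$ and $1$-periodic in $s$ (so that $t\mapsto\omega(t/\tau,u,v)$ is $\tau$-periodic). Then there are an open set $U\subset\mathbb R^2$ containing $(0,0)$, two $C^1$ functions $\tau,h:U\to\mathbb R$ with $\tau(0,0)=\tau_0$ and $h(0,0)=0$, and a constant $\tau_1<\tau_0$,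 such that for every $(\varepsilon,\alpha)\in U$ we have $|\tau(\varepsilon,\alpha)-\tau_0|<\tau_1$, and the equation $$u''+u'^3+2uu'^2+(2u^2-1)u'+u=\varepsilon\,\omega\!\left(\frac{t}{\tau(\varepsilon,\alpha)},u,u'\right)$$ has a solution $\nu:\mathbb R\to\mathbb R$ with $\nu(\alpha)=a+h(\varepsilon,\alpha)$ and $\nu'(\alpha)=0$ that is periodic with period $\tau(\varepsilon,\alpha)$. -/

import Mathlib

/-- The damping coefficient `φ(u, v) = u² + (u + v)² - 1`; note that
`φ(u, v) v = v³ + 2 u v² + (2 u² - 1) v`. -/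
def damping (u v : ℝ) : ℝ := u ^ 2 + (u + v) ^ 2 - 1

/-- `u : ℝ → ℝ` is a (global, twice differentiable) solution of the second order equation
`u'' + [u² + (u + u')² - 1] u' + u = p(t, u, u')`. -/
def IsLienardSolution (p : ℝ → ℝ → ℝ → ℝ) (u : ℝ → ℝ) : Prop :=
  Differentiable ℝ u ∧ Differentiable ℝ (deriv u) ∧
    ∀ t, deriv (deriv u) t + damping (u t) (deriv u t) * deriv u t + u t
      = p t (u t) (deriv u t)

/-- The vector field of the plane system equivalent to the unperturbed equation, in the
phase coordinates `x = (x₁, x₂) = (u', u)`. -/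
def lienardField (x : ℝ × ℝ) : ℝ × ℝ := (-(damping x.2 x.1 * x.1) - x.2, x.1)

/-- The phase curve `t ↦ (u'(t), u(t))`. -/
noncomputable def phaseCurve (u : ℝ → ℝ) (t : ℝ) : ℝ × ℝ := (deriv u t, u t)

/-- `Φ` is the fundamental solution, normalized by `Φ(0) = id`, of the variational system
`y' = f'(q(t)) y` of `x' = f(x)` along `q`. -/
def IsVariationalFundamental (f : ℝ × ℝ → ℝ × ℝ) (q : ℝ → ℝ × ℝ)
    (Φ : ℝ → (ℝ × ℝ →L[ℝ] ℝ × ℝ)) : Prop :=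
  Φ 0 = ContinuousLinearMap.id ℝ (ℝ × ℝ) ∧
    ∀ t, HasDerivAt Φ ((fderiv ℝ f (q t)).comp (Φ t)) t

/-- `ρ` is a simple characteristic multiplier of the variational system of `x' = f(x)` along
the `T`-periodic curve `q`: a simple root of the characteristic polynomial of `Φ(T)`, where
`Φ` is the fundamental solution with `Φ(0) = id`. -/
def IsSimpleCharacteristicMultiplier (f : ℝ × ℝ → ℝ × ℝ) (q : ℝ → ℝ × ℝ) (T ρ : ℝ) : Prop :=
  ∃ Φ : ℝ → (ℝ × ℝ →L[ℝ] ℝ × ℝ), IsVariationalFundamental f q Φ ∧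
    (LinearMap.charpoly (Φ T : ℝ × ℝ →ₗ[ℝ] ℝ × ℝ)).rootMultiplicity ρ = 1

/-! Put `t = α + τ s`, so that the unknown period becomes a parameter. A `τ`-periodic solution is
then a continuous curve `x` on `[0,1]` with `x(s) = x(1) + τ ∫₀ˢ g(ε, α/τ + r, x(r)) dr`, and the
phase condition is `x₁(0) = 0`. These are the zeros of `periodicDefect`, and the Banach space
implicit function theorem solves for `(x, τ)` in terms of `(ε, α)` near `(q(τ₀ ·), τ₀)`. No flow is
needed: smoothness comes from `contDiff_superposition` and the boundedness of `primitive`.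

The linearization in `(x, τ)` must be bijective. Variation of constants
(`bijective_periodic_linearization`) reduces this to the bordered system `(b, θ) ↦ (Φ(τ₀) b - b + θ
f(q(0)), b₁)`. The velocity `f(q(0)) = (-a, 0)` is fixed by the monodromy and transverse to the
section `x₁ = 0`. Simplicity of the multiplier `1` makes the other eigenvalue different from `1`, so
the bordered system is invertible (`bijective_bordered_of_simple`). Finally
`exists_periodic_solution` turns a zero of the defect into a periodic solution on the line. -/

open Set Filter Topology MeasureTheory

/-! ### Superposition operators on spaces of continuous functions. -/

section Superposition

variable {K : Type*} [TopologicalSpace K] [CompactSpace K]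
  {E F : Type*} [NormedAddCommGroup E] [NormedSpace ℝ E] [NormedAddCommGroup F] [NormedSpace ℝ F]

/-- Pointwise application of a continuous family of continuous linear maps, as a bounded bilinear
map of spaces of continuous functions. -/
noncomputable def pointwiseApply : C(K, E →L[ℝ] F) →L[ℝ] C(K, E) →L[ℝ] C(K, F) :=
  LinearMap.mkContinuous₂
    (LinearMap.mk₂ ℝ (fun (A : C(K, E →L[ℝ] F)) (y : C(K, E)) => (⟨fun s => A s (y s), by fun_prop⟩ : C(K, F)))
      (fun _ _ _ => by ext; simp) (fun _ _ _ => by ext; simp)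
      (fun _ _ _ => by ext; simp) (fun _ _ _ => by ext; simp)) 1
    (fun A y => by
      rw [ContinuousMap.norm_le _ (by positivity : (0 : ℝ) ≤ 1 * ‖A‖ * ‖y‖)]
      intro s
      simp only [LinearMap.mk₂_apply, ContinuousMap.coe_mk, one_mul]
      exact (A s).le_of_opNorm_le_of_le (A.norm_coe_le_norm s) (y.norm_coe_le_norm s))

@[simp] theorem pointwiseApply_apply (A : C(K, E →L[ℝ] F)) (y : C(K, E)) (s : K) :
    pointwiseApply A y s = A s (y s) := rfl

/-- The superposition (Nemytskii) operator of a `C¹` function is differentiable on the space of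
continuous functions on a compact space. -/
theorem hasFDerivAt_superposition {g : E → F} (hg : ContDiff ℝ 1 g) (x : C(K, E)) :
    HasFDerivAt (fun y : C(K, E) => (⟨g, hg.continuous⟩ : C(E, F)).comp y)
      (pointwiseApply
        ((⟨fderiv ℝ g, hg.continuous_fderiv one_ne_zero⟩ : C(E, E →L[ℝ] F)).comp x)) x := by
  rw [hasFDerivAt_iff_isLittleO, Asymptotics.isLittleO_iff]
  intro c hc
  have hcomp : IsCompact (range x) := isCompact_range x.continuous
  -- Compactness of the range of `x` gives one `δ` for all `s`; the mean value inequality on each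
  -- ball then yields a uniform remainder.
  have hu := hcomp.uniformContinuousAt_of_continuousAt (fderiv ℝ g)
    (fun a _ => (hg.continuous_fderiv one_ne_zero).continuousAt) (Metric.dist_mem_uniformity hc)
  obtain ⟨δ, hδ, hδc⟩ := Metric.mem_uniformity_dist.1 hu
  filter_upwards [Metric.ball_mem_nhds x hδ] with y hy
  rw [ContinuousMap.norm_le _ (by positivity)]
  intro s
  have hys : dist (y s) (x s) < δ := (ContinuousMap.dist_apply_le_dist s).trans_lt hy
  have hmv := (convex_ball (x s) δ).norm_image_sub_le_of_norm_hasFDerivWithin_le' (f := g)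
    (f' := fderiv ℝ g) (φ := fderiv ℝ g (x s)) (C := c) (x := x s) (y := y s)
    (fun z _ => (hg.differentiable one_ne_zero z).hasFDerivAt.hasFDerivWithinAt)
    (fun z hz => by
      have h1 : dist (fderiv ℝ g (x s)) (fderiv ℝ g z) < c :=
        hδc (by rw [dist_comm]; exact hz) ⟨s, rfl⟩
      rw [← dist_eq_norm, dist_comm]; exact h1.le)
    (Metric.mem_ball_self hδ) hys
  exact hmv.trans (mul_le_mul_of_nonneg_left ((y - x).norm_coe_le_norm s) hc.le)

/-- The derivative at `x` is multiplication by `Dg ∘ x`, and postcomposition with the continuous map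
`Dg` is continuous in the sup norm. -/
theorem contDiff_superposition {g : E → F} (hg : ContDiff ℝ 1 g) :
    ContDiff ℝ 1 (fun y : C(K, E) => (⟨g, hg.continuous⟩ : C(E, F)).comp y) := by
  rw [contDiff_one_iff_hasFDerivAt]
  exact ⟨_, (pointwiseApply (K := K)).continuous.comp (ContinuousMap.continuous_postcomp _),
    hasFDerivAt_superposition hg⟩

end Superposition

/-! ### Integration as a bounded operator on `C([0,1], E)`. -/

section Primitive

variable {E : Type*} [NormedAddCommGroup E]

/-- Extension of a continuous function on the unit interval by constants. -/
noncomputable def extendUnit (y : C(unitInterval, E)) : C(ℝ, E) :=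
  ⟨IccExtend zero_le_one y, y.continuous.Icc_extend'⟩

@[simp] theorem extendUnit_coe (y : C(unitInterval, E)) (s : unitInterval) :
    extendUnit y s = y s := IccExtend_val zero_le_one y s

theorem norm_extendUnit_le (y : C(unitInterval, E)) (s : ℝ) : ‖extendUnit y s‖ ≤ ‖y‖ :=
  y.norm_coe_le_norm _

variable [NormedSpace ℝ E]

/-- The primitive vanishing at `0` of a continuous function on the unit interval. -/
noncomputable def primitive : C(unitInterval, E) →L[ℝ] C(unitInterval, E) :=
  LinearMap.mkContinuous
    { toFun := fun y => ⟨fun s => ∫ r in (0 : ℝ)..s, extendUnit y r,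
        (intervalIntegral.continuous_primitive
          (fun _ _ => (extendUnit y).continuous.intervalIntegrable _ _) 0).comp
          continuous_subtype_val⟩
      map_add' := fun y z => by
        ext s
        exact intervalIntegral.integral_add ((extendUnit y).continuous.intervalIntegrable _ _)
          ((extendUnit z).continuous.intervalIntegrable _ _)
      map_smul' := fun c y => by
        ext s
        exact intervalIntegral.integral_smul c _ } 1
    (fun y => by
      rw [ContinuousMap.norm_le _ (by positivity)]
      intro s
      have h := intervalIntegral.norm_integral_le_of_norm_le_const (a := 0) (b := (s : ℝ))
        (fun r _ => norm_extendUnit_le y r)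
      refine h.trans ?_
      rw [sub_zero, abs_of_nonneg s.2.1, one_mul]
      exact mul_le_of_le_one_right (norm_nonneg _) s.2.2)

theorem primitive_apply (y : C(unitInterval, E)) (s : unitInterval) :
    primitive y s = ∫ r in (0 : ℝ)..s, extendUnit y r := rfl

/-- If `w' = y` on the unit interval then `w - w(0)` is the primitive of `y`. -/
theorem primitive_eq_sub [CompleteSpace E] {y : C(unitInterval, E)} {w w' : ℝ → E}
    (hw : ∀ s, HasDerivAt w (w' s) s) (hw' : Continuous w') (hy : ∀ s : unitInterval, y s = w' s)
    (s : unitInterval) : primitive y s = w s - w 0 := by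
  rw [primitive_apply, ← intervalIntegral.integral_eq_sub_of_hasDerivAt (fun r _ => hw r)
    (hw'.intervalIntegrable _ _)]
  refine intervalIntegral.integral_congr fun r hr => ?_
  rw [uIcc_of_le s.2.1] at hr
  have hr' : r ∈ Icc (0 : ℝ) 1 := ⟨hr.1, hr.2.trans s.2.2⟩
  exact (extendUnit_coe y ⟨r, hr'⟩).trans (hy ⟨r, hr'⟩)

end Primitive

/-! ### Linear differential equations and fundamental solutions. -/

section LinearEquation

variable {E : Type*} [NormedAddCommGroup E] [NormedSpace ℝ E]

/-- On a compact interval `A` is bounded, so the field is uniformly Lipschitz and uniqueness applies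
against the zero solution. -/
theorem eq_zero_of_hasDerivAt_clm_apply {A : ℝ → E →L[ℝ] E} (hA : Continuous A) {y : ℝ → E}
    (hy : ∀ t, HasDerivAt y (A t (y t)) t) {t₀ : ℝ} (h₀ : y t₀ = 0) (t : ℝ) : y t = 0 := by
  set a := min t t₀ - 1
  set b := max t t₀ + 1
  obtain ⟨C, hC⟩ := isCompact_Icc.exists_bound_of_continuousOn (s := Icc a b) hA.continuousOn
  have hlip : ∀ s ∈ Ioo a b, LipschitzOnWith C.toNNReal (fun v => A s v) univ := fun s hs =>
    ((A s).lipschitz.weaken (by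
      rw [← NNReal.coe_le_coe, coe_nnnorm]
      exact (hC s (Ioo_subset_Icc_self hs)).trans (Real.le_coe_toNNReal C))).lipschitzOnWith
  have ht₀ : t₀ ∈ Ioo a b := by constructor <;> simp only [a, b] <;> grind
  have ht : t ∈ Icc a b := by constructor <;> simp only [a, b] <;> grind
  have hcont : Continuous y := continuous_iff_continuousAt.2 fun s => (hy s).continuousAt
  exact ODE_solution_unique_of_mem_Icc (v := fun s v => A s v) (s := fun _ => univ) (g := fun _ => 0)
    hlip ht₀ hcont.continuousOn (fun s _ => hy s) (fun _ _ => trivial) continuousOn_const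
    (fun s _ => by simpa using hasDerivAt_const s (0 : E)) (fun _ _ => trivial) h₀ ht

/-- A fundamental matrix is invertible, and its inverse solves the adjoint equation. -/
theorem exists_inverse_fundamental [FiniteDimensional ℝ E] {A Φ : ℝ → E →L[ℝ] E}
    (hA : Continuous A) (h0 : Φ 0 = ContinuousLinearMap.id ℝ E)
    (hΦ : ∀ t, HasDerivAt Φ ((A t).comp (Φ t)) t) :
    ∃ Ψ : ℝ → E →L[ℝ] E, (∀ t, (Φ t).comp (Ψ t) = ContinuousLinearMap.id ℝ E) ∧
      (∀ t, (Ψ t).comp (Φ t) = ContinuousLinearMap.id ℝ E) ∧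
      ∀ t, HasDerivAt Ψ (-(Ψ t).comp (A t)) t := by
  -- If `Φ t v = 0`, the solution `s ↦ Φ s v` vanishes identically, and its value at `0` is `v`.
  have hinj : ∀ t, Function.Injective (Φ t) := by
    intro t
    rw [injective_iff_map_eq_zero]
    intro v hv
    have hsol : ∀ s, HasDerivAt (fun s => Φ s v) (A s (Φ s v)) s := fun s => by
      simpa using (hΦ s).clm_apply (hasDerivAt_const s v)
    simpa [h0] using eq_zero_of_hasDerivAt_clm_apply hA hsol hv 0
  have hunit : ∀ t, IsUnit (Φ t) := fun t => by
    have hbij : Function.Bijective (Φ t : E →ₗ[ℝ] E) :=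
      ⟨hinj t, LinearMap.injective_iff_surjective.1 (hinj t)⟩
    refine ⟨ContinuousLinearEquiv.toUnit
      (LinearEquiv.ofBijective (Φ t : E →ₗ[ℝ] E) hbij).toContinuousLinearEquiv, ?_⟩
    ext v
    rfl
  have : CompleteSpace E := FiniteDimensional.complete ℝ E
  refine ⟨fun t => Ring.inverse (Φ t), fun t => Ring.mul_inverse_cancel _ (hunit t),
    fun t => Ring.inverse_mul_cancel _ (hunit t), fun t => ?_⟩
  obtain ⟨u, hu⟩ := hunit t
  have h1 := hasFDerivAt_ringInverse (𝕜 := ℝ) u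
  rw [hu] at h1
  have h2 := h1.comp_hasDerivAt t (hΦ t)
  refine h2.congr_deriv ?_
  have hinv : (↑u⁻¹ : E →L[ℝ] E) = Ring.inverse (Φ t) := by rw [← hu, Ring.inverse_unit]
  simp only [hinv, neg_apply, ContinuousLinearMap.mulLeftRight_apply]
  change -(Ring.inverse (Φ t) * (A t * Φ t) * Ring.inverse (Φ t)) = -(Ring.inverse (Φ t) * A t)
  rw [mul_assoc, mul_assoc, Ring.mul_inverse_cancel _ ⟨u, hu⟩, mul_one]

/-- Variation of constants: for `y' = A y + b` the derivative of `Φ⁻¹ y` is `Φ⁻¹ b`. -/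
theorem hasDerivAt_inverse_fundamental_apply {A Ψ : ℝ → E →L[ℝ] E}
    {t : ℝ} (hΨ : HasDerivAt Ψ (-(Ψ t).comp (A t)) t) {y : ℝ → E} {b : E}
    (hy : HasDerivAt y (A t (y t) + b) t) : HasDerivAt (fun s => Ψ s (y s)) (Ψ t b) t := by
  refine (hΨ.clm_apply hy).congr_deriv ?_
  simp

/-- Applied to the velocity along the periodic orbit, this gives the eigenvector of the monodromy
for the eigenvalue `1`. -/
theorem eq_fundamental_apply [FiniteDimensional ℝ E] {A Φ : ℝ → E →L[ℝ] E}
    (hA : Continuous A) (h0 : Φ 0 = ContinuousLinearMap.id ℝ E)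
    (hΦ : ∀ t, HasDerivAt Φ ((A t).comp (Φ t)) t) {y : ℝ → E}
    (hy : ∀ t, HasDerivAt y (A t (y t)) t) (t : ℝ) : y t = Φ t (y 0) := by
  have hd : ∀ s, HasDerivAt (fun s => y s - Φ s (y 0)) (A s (y s - Φ s (y 0))) s := fun s => by
    refine ((hy s).sub ((hΦ s).clm_apply (hasDerivAt_const s (y 0)))).congr_deriv ?_
    simp
  exact sub_eq_zero.1 (eq_zero_of_hasDerivAt_clm_apply hA hd (t₀ := 0) (by simp [h0]) t)

end LinearEquation

/-! ### Reduction of the linearized boundary value problem to finite dimension. -/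

section PeriodicLinearization

variable {E : Type*} [NormedAddCommGroup E] [NormedSpace ℝ E] [FiniteDimensional ℝ E]

/-- The linearized periodic boundary value problem
`ξ(s) - ξ(1) - θ ∫₀ˢ v - ∫₀ˢ M ξ = z(s)`, `π (ξ(0)) = c` is uniquely solvable as soon as the
corresponding finite-dimensional problem for the monodromy operator `Φ(1)` is. -/
theorem bijective_periodic_linearization {M Φ : ℝ → E →L[ℝ] E} (hM : Continuous M)
    (h0 : Φ 0 = ContinuousLinearMap.id ℝ E) (hΦ : ∀ t, HasDerivAt Φ ((M t).comp (Φ t)) t)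
    {v : ℝ → E} (hv : ∀ t, HasDerivAt v (M t (v t)) t) (π : E →L[ℝ] ℝ)
    (hπ : Function.Bijective (fun p : E × ℝ => (Φ 1 p.1 - p.1 + p.2 • v 1, π p.1)))
    {MI : C(unitInterval, E →L[ℝ] E)} (hMI : ∀ s : unitInterval, MI s = M s)
    {vI : C(unitInterval, E)} (hvI : ∀ s : unitInterval, vI s = v s) :
    Function.Bijective (fun p : C(unitInterval, E) × ℝ =>
      (p.1 - ContinuousMap.const _ (p.1 1) - p.2 • primitive vI - primitive (pointwiseApply MI p.1),
        π (p.1 0))) := by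
  have : CompleteSpace E := FiniteDimensional.complete ℝ E
  obtain ⟨Ψ, hΦΨ, hΨΦ, hΨ⟩ := exists_inverse_fundamental hM h0 hΦ
  have hΨ0 : Ψ 0 = ContinuousLinearMap.id ℝ E := by simpa [h0] using hΨΦ 0
  have hvc : Continuous v := continuous_iff_continuousAt.2 fun s => (hv s).continuousAt
  have hΨc : Continuous Ψ := continuous_iff_continuousAt.2 fun s => (hΨ s).continuousAt
  have hΦc : Continuous Φ := continuous_iff_continuousAt.2 fun s => (hΦ s).continuousAt
  -- Since `v` solves the homogeneous equation, `θ s v(s)` is a particular solution for the forcing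
  -- `θ v`.
  have hsv : ∀ (θ s : ℝ), HasDerivAt (fun s => (θ * s) • v s) (M s ((θ * s) • v s) + θ • v s) s :=
    fun θ s => by
      have h1 : HasDerivAt (fun s : ℝ => θ * s) θ s := by
        simpa using (hasDerivAt_id s).const_mul θ
      refine (h1.smul (hv s)).congr_deriv ?_
      simp
  have hcoe0 : ((0 : unitInterval) : ℝ) = 0 := rfl
  have hcoe1 : ((1 : unitInterval) : ℝ) = 1 := rfl
  constructor
  · rintro ⟨ξ, θ⟩ ⟨ξ', θ'⟩ heq
    suffices h : ∀ (y : C(unitInterval, E)) (k : ℝ),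
        y - ContinuousMap.const _ (y 1) - k • primitive vI - primitive (pointwiseApply MI y) = 0 →
        π (y 0) = 0 → y = 0 ∧ k = 0 by
      obtain ⟨h1, h2⟩ := Prod.mk.injEq _ _ _ _ ▸ heq
      have := h (ξ - ξ') (θ - θ') (by
        rw [← sub_eq_zero] at h1
        rw [← h1]
        simp only [map_sub, sub_smul, ContinuousMap.sub_apply]
        ext s
        simp
        abel) (by simpa [sub_eq_zero] using h2)
      exact Prod.ext (sub_eq_zero.1 this.1) (sub_eq_zero.1 this.2)
    intro y k hy hy0
    have hys : ∀ s, y s = y 1 + k • (∫ r in (0 : ℝ)..s, extendUnit vI r)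
        + ∫ r in (0 : ℝ)..s, extendUnit (pointwiseApply MI y) r := fun s => by
      have := congrArg (fun f : C(unitInterval, E) => f s) hy
      simp only [ContinuousMap.sub_apply, ContinuousMap.const_apply, ContinuousMap.smul_apply,
        primitive_apply, ContinuousMap.zero_apply] at this
      rw [sub_eq_zero, sub_eq_iff_eq_add, sub_eq_iff_eq_add] at this
      rw [this]; abel
    have hy01 : y 0 = y 1 := by simpa using hys 0
    -- A differentiable extension of `y` to the line.
    set Y : ℝ → E := fun s => y 1 + k • (∫ r in (0 : ℝ)..s, v r)
        + ∫ r in (0 : ℝ)..s, M r (extendUnit y r) with hYdef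
    have hYy : ∀ s : unitInterval, y s = Y s := fun s => by
      rw [hys s, hYdef]
      have hmem : ∀ r ∈ uIcc (0 : ℝ) s, r ∈ unitInterval := fun r hr => by
        rw [uIcc_of_le s.2.1] at hr
        exact ⟨hr.1, hr.2.trans s.2.2⟩
      refine congrArg₂ (· + ·) (congrArg (fun e => y 1 + k • e) ?_) ?_
      · exact intervalIntegral.integral_congr fun r hr =>
          (extendUnit_coe vI ⟨r, hmem r hr⟩).trans (hvI ⟨r, hmem r hr⟩)
      · refine intervalIntegral.integral_congr fun r hr => ?_
        have := extendUnit_coe (pointwiseApply MI y) ⟨r, hmem r hr⟩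
        rw [pointwiseApply_apply, hMI, ← extendUnit_coe] at this
        exact this
    have hYd : ∀ s, HasDerivAt Y (k • v s + M s (extendUnit y s)) s := fun s => by
      have h1 := intervalIntegral.integral_hasDerivAt_right (hvc.intervalIntegrable 0 s)
        (hvc.stronglyMeasurableAtFilter _ _) hvc.continuousAt
      have hc : Continuous fun r => M r (extendUnit y r) := hM.clm_apply (extendUnit y).continuous
      have h2 := intervalIntegral.integral_hasDerivAt_right (hc.intervalIntegrable 0 s)
        (hc.stronglyMeasurableAtFilter _ _) hc.continuousAt
      exact ((h1.const_smul k).const_add (y 1)).add h2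
    -- On `[0,1]` both `Y` and `k s v` solve `y' = M y + k v`; their difference is homogeneous, and
    -- `Ψ` makes it constant.
    have hconst : ∀ s ∈ Icc (0 : ℝ) 1, Ψ s (Y s - (k * s) • v s) = Ψ 0 (Y 0 - (k * 0) • v 0) := by
      have hd : ∀ s ∈ Icc (0 : ℝ) 1, HasDerivAt (fun s => Ψ s (Y s - (k * s) • v s)) 0 s := by
        intro s hs
        have hE : extendUnit y s = Y s := (extendUnit_coe y ⟨s, hs⟩).trans (hYy ⟨s, hs⟩)
        have h1 := (hYd s).sub (hsv k s)
        have h2 := hasDerivAt_inverse_fundamental_apply (hΨ s) (b := 0)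
          (h1.congr_deriv (by rw [hE]; simp only [Pi.sub_apply, map_sub, add_zero]; abel))
        simpa using h2
      intro s hs
      exact constant_of_has_deriv_right_zero
        (fun s hs => (hd s hs).continuousAt.continuousWithinAt)
        (fun s hs => (hd s (Ico_subset_Icc_self hs)).hasDerivWithinAt) s hs
    have hY0 : Y 0 = y 1 := by simp [hYdef]
    have hform : ∀ s ∈ Icc (0 : ℝ) 1, Y s = Φ s (y 1) + (k * s) • v s := fun s hs => by
      have h1 := hconst s hs
      simp only [hΨ0, hY0, mul_zero, zero_smul, sub_zero, ContinuousLinearMap.id_apply] at h1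
      have h2 := congrArg (Φ s) h1
      rw [← ContinuousLinearMap.comp_apply, hΦΨ, ContinuousLinearMap.id_apply] at h2
      rw [← h2]; abel
    have hfin : ((y 1, k) : E × ℝ) = (0, 0) := by
      apply hπ.1
      have h1 := hform 1 (by simp)
      rw [← hcoe1, ← hYy 1, hcoe1, mul_one] at h1
      simp only [map_zero, sub_zero, zero_smul, add_zero, Prod.mk.injEq]
      refine ⟨?_, by rw [← hy01, hy0]⟩
      rw [sub_add_eq_add_sub, ← h1, sub_self]
    obtain ⟨hb, hk⟩ := Prod.mk.injEq _ _ _ _ ▸ hfin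
    refine ⟨?_, hk⟩
    ext s
    rw [hYy s, hform s s.2, hb, hk]
    simp
  · rintro ⟨z, c⟩
    have hMz : Continuous fun r => Ψ r (M r (extendUnit z r)) :=
      hΨc.clm_apply (hM.clm_apply (extendUnit z).continuous)
    set R : ℝ → E := fun s => ∫ r in (0 : ℝ)..s, Ψ r (M r (extendUnit z r)) with hR
    have hRd : ∀ s, HasDerivAt R (Ψ s (M s (extendUnit z s))) s := fun s =>
      intervalIntegral.integral_hasDerivAt_right (hMz.intervalIntegrable 0 s)
        (hMz.stronglyMeasurableAtFilter _ _) hMz.continuousAt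
    -- With `ξ = w + z` and `w(0) = b`, this right-hand side encodes `ξ(1) = b` and `π (ξ(0)) = c`.
    obtain ⟨⟨b, θ⟩, hbθ⟩ := hπ.2 (-z 1 - Φ 1 (R 1), c - π (z 0))
    obtain ⟨hb1, hb2⟩ := Prod.mk.injEq _ _ _ _ ▸ hbθ
    set w : ℝ → E := fun s => Φ s (b + R s) + (θ * s) • v s with hw
    have hwd : ∀ s, HasDerivAt w (M s (w s + extendUnit z s) + θ • v s) s := fun s => by
      have h1 := ((hΦ s).clm_apply ((hRd s).const_add b)).add (hsv θ s)
      refine h1.congr_deriv ?_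
      have h2 : ∀ e, Φ s (Ψ s e) = e := fun e => congrArg (fun T : E →L[ℝ] E => T e) (hΦΨ s)
      simp only [h2, hw, ContinuousLinearMap.comp_apply, map_add]
      abel
    have hwc : Continuous w := continuous_iff_continuousAt.2 fun s => (hwd s).continuousAt
    have hw0 : w 0 = b := by simp [hw, hR, h0]
    set ξ : C(unitInterval, E) := ⟨fun s => w s, hwc.comp continuous_subtype_val⟩ + z with hξ
    have hξs : ∀ s, ξ s = w s + z s := fun s => rfl
    have hξ1 : ξ 1 = b := by
      have h3 : w 1 = b + (Φ 1 b - b + θ • v 1) + Φ 1 (R 1) := by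
        simp only [hw, map_add, mul_one]; abel
      rw [hξs, hcoe1, h3, hb1]; abel
    refine ⟨(ξ, θ), Prod.ext ?_ ?_⟩
    · have h4 : ∀ s, primitive (θ • vI + pointwiseApply MI ξ) s = w s - w 0 :=
        primitive_eq_sub hwd ((hM.clm_apply (hwc.add (extendUnit z).continuous)).add
          (hvc.const_smul θ)) fun s => by
            simp only [ContinuousMap.add_apply, ContinuousMap.smul_apply, pointwiseApply_apply,
              hMI, hvI, hξs, extendUnit_coe]
            rw [add_comm]
      ext s
      have h5 := h4 s
      rw [map_add, map_smul, hw0, ContinuousMap.add_apply] at h5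
      simp only [ContinuousMap.sub_apply, ContinuousMap.const_apply, hξ1]
      rw [sub_sub, h5, hξs]
      abel
    · change π (ξ 0) = c
      rw [hξs, hcoe0, hw0, map_add, hb2]
      abel

end PeriodicLinearization

/-! ### From the integrated problem on `[0,1]` to a periodic solution on the line. -/

/-- A continuous curve on the unit interval that solves the integrated boundary value problem for
a `1`-periodic vector field extends to a `1`-periodic solution on the real line. -/
theorem exists_periodic_solution {E : Type*} [NormedAddCommGroup E] [NormedSpace ℝ E]
    [CompleteSpace E] {F : ℝ → E → E}
    (hF : Continuous fun p : ℝ × E => F p.1 p.2) (hper : ∀ s v, F (s + 1) v = F s v)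
    {τ : ℝ} {x : C(unitInterval, E)}
    (hx : ∀ s : unitInterval, x s = x 1 + τ • ∫ r in (0 : ℝ)..s, F r (extendUnit x r)) :
    ∃ X : ℝ → E, Function.Periodic X 1 ∧ X 0 = x 0 ∧ ∀ s, HasDerivAt X (τ • F s (X s)) s := by
  set X : ℝ → E := fun s => extendUnit x (Int.fract s) with hX
  have hx01 : x 0 = x 1 := by simpa using hx 0
  have he0 : extendUnit x 0 = x 0 := extendUnit_coe x 0
  have he1 : extendUnit x 1 = x 1 := extendUnit_coe x 1
  have hXper : Function.Periodic X 1 := fun s => by simp [hX]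
  have hXe : ∀ s ∈ Icc (0 : ℝ) 1, X s = extendUnit x s := fun s hs => by
    rcases hs.2.lt_or_eq with h | h
    · simp only [hX]
      rw [Int.fract_eq_self.2 ⟨hs.1, h⟩]
    · simp only [hX, h, Int.fract_one, he0, he1, hx01]
  have hXc : Continuous X :=
    (extendUnit x).continuous.continuousOn.comp_fract'' (by rw [he0, he1, hx01])
  set p : ℝ → E := fun s => F s (X s) with hp
  have hpc : Continuous p := hF.comp (continuous_id.prodMk hXc)
  have hpper : Function.Periodic p 1 := fun s => by simp only [hp, hper, hXper s]
  set P : ℝ → E := fun s => x 1 + τ • ∫ r in (0 : ℝ)..s, p r with hP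
  have hPX : ∀ s ∈ Icc (0 : ℝ) 1, P s = X s := fun s hs => by
    rw [hXe s hs]
    refine Eq.trans ?_ ((hx ⟨s, hs⟩).symm.trans (extendUnit_coe x ⟨s, hs⟩).symm)
    refine congrArg (fun e => x 1 + τ • e) (intervalIntegral.integral_congr fun r hr => ?_)
    rw [uIcc_of_le hs.1] at hr
    exact congrArg (F r) (hXe r ⟨hr.1, hr.2.trans hs.2⟩)
  have hPper : Function.Periodic P 1 := fun s => by
    have h1 : P 1 = P 0 := by
      rw [hPX 1 (by simp), hPX 0 (by simp)]
      simpa using hXper 0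
    have h2 := intervalIntegral.integral_add_adjacent_intervals
      (hpc.intervalIntegrable (μ := volume) 0 s) (hpc.intervalIntegrable s (s + 1))
    rw [hpper.intervalIntegral_add_eq s 0, zero_add] at h2
    simp only [hP, ← h2, smul_add]
    simp only [hP, intervalIntegral.integral_same, smul_zero, add_zero, add_eq_left] at h1
    rw [h1, add_zero]
  -- `X` is only known to be continuous at the integers; equality with the primitive `P` makes it
  -- differentiable there too.
  have hXP : X = P := by
    funext s
    have h1 : X (Int.fract s) = X s := by simp [hX]
    have h2 : P (Int.fract s) = P s := by
      have := hPper.sub_int_mul_eq ⌊s⌋ (x := s)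
      rwa [mul_one] at this
    rw [← h1, ← h2, hPX _ ⟨Int.fract_nonneg s, (Int.fract_lt_one s).le⟩]
  refine ⟨X, hXper, (hXe 0 (by simp)).trans he0, fun s => ?_⟩
  have hd : HasDerivAt P (τ • p s) s :=
    ((intervalIntegral.integral_hasDerivAt_right (hpc.intervalIntegrable 0 s)
      (hpc.stronglyMeasurableAtFilter _ _) hpc.continuousAt).const_smul τ).const_add (x 1)
  rw [← hXP] at hd
  exact hd

/-! ### The Liénard system and its bordered monodromy. -/

section Lienard

theorem contDiff_lienardField {n : WithTop ℕ∞} : ContDiff ℝ n lienardField := by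
  unfold lienardField damping
  fun_prop

theorem IsLienardSolution.hasDerivAt_phaseCurve {p : ℝ → ℝ → ℝ → ℝ} {u : ℝ → ℝ}
    (hu : IsLienardSolution p u) (t : ℝ) :
    HasDerivAt (phaseCurve u)
      (lienardField (phaseCurve u t) + (p t (u t) (deriv u t), 0)) t := by
  obtain ⟨h1, h2, h3⟩ := hu
  refine ((h2 t).hasDerivAt.prodMk (h1 t).hasDerivAt).congr_deriv ?_
  ext
  · simp [lienardField, phaseCurve, ← h3 t]
  · simp [lienardField, phaseCurve]

theorem periodic_phaseCurve {u : ℝ → ℝ} {T : ℝ} (hu : Function.Periodic u T) :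
    Function.Periodic (phaseCurve u) T := fun t => by
  have h : deriv u (t + T) = deriv u t := by
    rw [← deriv_comp_add_const]
    exact congrArg (fun f => deriv f t) (funext hu)
  simp only [phaseCurve, h, hu t]

/-- A curve of speed `τ` along the perturbed Liénard field gives a solution of the second order
equation after rescaling time. -/
theorem isLienardSolution_of_hasDerivAt {p : ℝ → ℝ → ℝ → ℝ} {X : ℝ → ℝ × ℝ} {τ α : ℝ}
    (hτ : τ ≠ 0) (hX : ∀ s, HasDerivAt X
      (τ • (lienardField (X s) + (p (α + τ * s) (X s).2 (X s).1, 0))) s) :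
    IsLienardSolution p (fun t => (X ((t - α) / τ)).2) ∧
      deriv (fun t => (X ((t - α) / τ)).2) = fun t => (X ((t - α) / τ)).1 := by
  have hY : ∀ t, HasDerivAt (fun t => X ((t - α) / τ))
      (lienardField (X ((t - α) / τ)) +
        (p t (X ((t - α) / τ)).2 (X ((t - α) / τ)).1, 0)) t := fun t => by
    have h1 : HasDerivAt (fun t => (t - α) / τ) (1 / τ) t :=
      ((hasDerivAt_id t).sub_const α).div_const τ
    refine ((hX ((t - α) / τ)).scomp t h1).congr_deriv ?_
    rw [smul_smul, one_div_mul_cancel hτ, one_smul, mul_div_cancel₀ _ hτ, add_sub_cancel]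
  have h1 : ∀ t, HasDerivAt (fun t => (X ((t - α) / τ)).1) _ t := fun t =>
    (hasFDerivAt_fst (𝕜 := ℝ)).comp_hasDerivAt t (hY t)
  have h2 : ∀ t, HasDerivAt (fun t => (X ((t - α) / τ)).2) _ t := fun t =>
    (hasFDerivAt_snd (𝕜 := ℝ)).comp_hasDerivAt t (hY t)
  have hd : deriv (fun t => (X ((t - α) / τ)).2) = fun t => (X ((t - α) / τ)).1 := by
    funext t
    rw [(h2 t).deriv]
    simp [lienardField]
  refine ⟨⟨fun t => (h2 t).differentiableAt, ?_, fun t => ?_⟩, hd⟩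
  · rw [hd]
    exact fun t => (h1 t).differentiableAt
  · rw [hd, (h1 t).deriv]
    simp [lienardField]
    ring

/-- If `1` is a simple eigenvalue of `T`, with an eigenvector along the first axis, then the
bordered linear system of `T - 1` is uniquely solvable. -/
theorem bijective_bordered_of_simple {T : ℝ × ℝ →L[ℝ] ℝ × ℝ} {c : ℝ} (hc : c ≠ 0)
    (hT : T (c, 0) = (c, 0))
    (hsimple : (LinearMap.charpoly (T : ℝ × ℝ →ₗ[ℝ] ℝ × ℝ)).rootMultiplicity 1 = 1) :
    Function.Bijective (fun p : (ℝ × ℝ) × ℝ =>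
      (T p.1 - p.1 + p.2 • ((c, 0) : ℝ × ℝ), ContinuousLinearMap.fst ℝ ℝ ℝ p.1)) := by
  have hT1 : T (1, 0) = (1, 0) := by
    have h1 : ((1, 0) : ℝ × ℝ) = c⁻¹ • (c, 0) := by simp [hc]
    rw [h1, map_smul, hT]
  set d := (T (0, 1)).2 with hd
  -- The matrix of `T` is upper triangular with diagonal `1, d`; for `d = 1` the root `1` would be
  -- double.
  have hd1 : d ≠ 1 := by
    intro h
    have hchar : LinearMap.charpoly (T : ℝ × ℝ →ₗ[ℝ] ℝ × ℝ) =
        (Polynomial.X - Polynomial.C 1) ^ 2 := by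
      rw [← LinearMap.charpoly_toMatrix _ (Module.Basis.finTwoProd ℝ), Matrix.charpoly_fin_two,
        Matrix.trace_fin_two, Matrix.det_fin_two]
      simp only [LinearMap.toMatrix_apply, Module.Basis.finTwoProd_zero,
        Module.Basis.finTwoProd_one, ContinuousLinearMap.coe_coe, hT1,
        Module.Basis.coe_finTwoProd_repr]
      simp [← hd, h]
      ring
    rw [hchar, Polynomial.rootMultiplicity_X_sub_C_pow] at hsimple
    omega
  have hadd : ∀ k, T (0, k) = (k * (T (0, 1)).1, k * d) := fun k => by
    have h1 : ((0, k) : ℝ × ℝ) = k • (0, 1) := by simp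
    rw [h1, map_smul]
    rfl
  let L : (ℝ × ℝ) × ℝ →ₗ[ℝ] (ℝ × ℝ) × ℝ :=
    { toFun := fun p =>
        (T p.1 - p.1 + p.2 • ((c, 0) : ℝ × ℝ), ContinuousLinearMap.fst ℝ ℝ ℝ p.1)
      map_add' := fun p q => by
        ext <;> simp <;> ring
      map_smul' := fun r p => by
        ext <;> simp <;> ring }
  have hinj : Function.Injective L := by
    rw [injective_iff_map_eq_zero]
    rintro ⟨⟨b₁, b₂⟩, θ⟩ h
    obtain ⟨h1, h2⟩ := Prod.mk.injEq _ _ _ _ ▸ (h : (_, _) = ((0 : ℝ × ℝ), (0 : ℝ)))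
    have hb1 : b₁ = 0 := h2
    subst hb1
    rw [hadd] at h1
    simp only [Prod.mk_sub_mk, Prod.smul_mk, Prod.mk_add_mk, smul_eq_mul, mul_zero, add_zero,
      sub_zero, Prod.mk_eq_zero] at h1
    have hb2 : b₂ = 0 := by
      have h3 : b₂ * (d - 1) = 0 := by linarith [h1.2]
      exact (mul_eq_zero.1 h3).resolve_right (sub_ne_zero.2 hd1)
    subst hb2
    have hθ : θ = 0 := by simpa [hc] using h1.1
    subst hθ
    rfl
  exact ⟨hinj, LinearMap.injective_iff_surjective.1 hinj⟩

end Lienard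

/-! ### The nonlinear boundary value problem and its derivative. -/

section PeriodicProblem

variable {E : Type*} [NormedAddCommGroup E] [NormedSpace ℝ E]

/-- The curve `s ↦ (ε, α / τ + s, x(s))` attached to `((ε, α), (x, τ))`. -/
noncomputable def augmentedCurve (P : (ℝ × ℝ) × (C(unitInterval, E) × ℝ)) :
    C(unitInterval, ℝ × ℝ × E) :=
  ContinuousLinearMap.const ℝ unitInterval (P.1.1, P.1.2 / P.2.2, (0 : E)) +
    ⟨fun s => (0, (s : ℝ), 0), by fun_prop⟩ +
    ((ContinuousLinearMap.inr ℝ ℝ (ℝ × E)).comp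
      (ContinuousLinearMap.inr ℝ ℝ E)).compLeftContinuous ℝ unitInterval P.2.1

theorem augmentedCurve_apply (P : (ℝ × ℝ) × (C(unitInterval, E) × ℝ)) (s : unitInterval) :
    augmentedCurve P s = (P.1.1, P.1.2 / P.2.2 + s, P.2.1 s) := by
  simp [augmentedCurve]

/-- The curve is affine in `ε`, `α / τ` and `x`, so only the quotient needs `τ ≠ 0`. -/
theorem contDiffAt_augmentedCurve {n : WithTop ℕ∞} {P : (ℝ × ℝ) × (C(unitInterval, E) × ℝ)}
    (hP : P.2.2 ≠ 0) : ContDiffAt ℝ n augmentedCurve P := by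
  unfold augmentedCurve
  have h1 : ContDiffAt ℝ n (fun P : (ℝ × ℝ) × (C(unitInterval, E) × ℝ) => P.1.2 / P.2.2) P :=
    ContDiffAt.div (by fun_prop) (by fun_prop) hP
  refine ContDiffAt.add (ContDiffAt.add ?_ contDiffAt_const) ?_
  · exact (ContinuousLinearMap.contDiff _).contDiffAt.comp P
      (ContDiffAt.prodMk (by fun_prop) (h1.prodMk contDiffAt_const))
  · exact (ContinuousLinearMap.contDiff _).contDiffAt.comp P (contDiffAt_fst.comp P contDiffAt_snd)

/-- The integrated periodic boundary value problem `x' = τ g(ε, α / τ + s, x)`, `x(0) = x(1)`,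
together with the phase condition `π (x(0)) = 0`. -/
noncomputable def periodicDefect (g : C(ℝ × ℝ × E, E)) (π : E →L[ℝ] ℝ)
    (P : (ℝ × ℝ) × (C(unitInterval, E) × ℝ)) : C(unitInterval, E) × ℝ :=
  (P.2.1 - ContinuousMap.const _ (P.2.1 1) - P.2.2 • primitive (g.comp (augmentedCurve P)),
    π (P.2.1 0))

theorem contDiffAt_periodicDefect {g : ℝ × ℝ × E → E} (hg : ContDiff ℝ 1 g) (π : E →L[ℝ] ℝ)
    {P : (ℝ × ℝ) × (C(unitInterval, E) × ℝ)} (hP : P.2.2 ≠ 0) :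
    ContDiffAt ℝ 1 (periodicDefect ⟨g, hg.continuous⟩ π) P := by
  have hx : ContDiffAt ℝ 1 (fun P : (ℝ × ℝ) × (C(unitInterval, E) × ℝ) => P.2.1) P := by fun_prop
  have hev : ∀ s : unitInterval,
      ContDiffAt ℝ 1 (fun P : (ℝ × ℝ) × (C(unitInterval, E) × ℝ) => P.2.1 s) P := fun s =>
    (ContinuousMap.evalCLM ℝ s : C(unitInterval, E) →L[ℝ] E).contDiff.contDiffAt.comp P hx
  refine ContDiffAt.prodMk (ContDiffAt.sub (hx.sub ?_) (ContDiffAt.smul (contDiffAt_snd.comp P contDiffAt_snd) ?_)) ?_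
  · exact (ContinuousLinearMap.const ℝ unitInterval : E →L[ℝ] _).contDiff.contDiffAt.comp P (hev 1)
  · exact (primitive (E := E)).contDiff.contDiffAt.comp P
      ((contDiff_superposition hg).contDiffAt.comp P (contDiffAt_augmentedCurve hP))
  · exact π.contDiff.contDiffAt.comp P (hev 0)

/-- The partial derivative of the periodic boundary value problem at vanishing parameters. -/
theorem fderiv_periodicDefect_comp_inr {g : ℝ × ℝ × E → E} (hg : ContDiff ℝ 1 g) {f : E → E}
    (hf : ContDiff ℝ 1 f) (hgf : ∀ s v, g (0, s, v) = f v) (π : E →L[ℝ] ℝ)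
    {x : C(unitInterval, E)} {τ : ℝ} (hτ : τ ≠ 0) {MI : C(unitInterval, E →L[ℝ] E)}
    (hMI : ∀ s, MI s = τ • fderiv ℝ f (x s)) (p : C(unitInterval, E) × ℝ) :
    (fderiv ℝ (periodicDefect ⟨g, hg.continuous⟩ π) ((0, 0), (x, τ)) ∘L
      ContinuousLinearMap.inr ℝ (ℝ × ℝ) (C(unitInterval, E) × ℝ)) p =
    (p.1 - ContinuousMap.const _ (p.1 1)
        - p.2 • primitive ((⟨f, hf.continuous⟩ : C(E, E)).comp x)
        - primitive (pointwiseApply MI p.1), π (p.1 0)) := by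
  have h1 := ((contDiffAt_periodicDefect hg π (P := ((0, 0), (x, τ))) hτ).differentiableAt
    one_ne_zero).hasFDerivAt.comp (x, τ) (hasFDerivAt_prodMk_right ((0 : ℝ), (0 : ℝ)) (x, τ))
  have hev : ∀ s : unitInterval, HasFDerivAt (fun y : C(unitInterval, E) × ℝ => y.1 s)
      ((ContinuousMap.evalCLM ℝ s).comp (ContinuousLinearMap.fst ℝ _ _)) (x, τ) := fun s =>
    (ContinuousMap.evalCLM ℝ s : C(unitInterval, E) →L[ℝ] E).hasFDerivAt.comp (x, τ) hasFDerivAt_fst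
  have h2 := ((hasFDerivAt_fst (𝕜 := ℝ) (E := C(unitInterval, E)) (F := ℝ) (p := (x, τ))).sub
    ((ContinuousLinearMap.const ℝ unitInterval : E →L[ℝ] _).hasFDerivAt.comp (x, τ) (hev 1))).sub
    ((hasFDerivAt_snd (𝕜 := ℝ) (E := C(unitInterval, E)) (F := ℝ) (p := (x, τ))).smul
      ((primitive (E := E)).hasFDerivAt.comp (x, τ)
        ((hasFDerivAt_superposition hf x).comp (x, τ) hasFDerivAt_fst)))
  have h3 := h2.prodMk (π.hasFDerivAt.comp (x, τ) (hev 0))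
  have h4 := h1.unique (h3.congr_of_eventuallyEq (Eventually.of_forall fun y => by
    refine Prod.ext ?_ rfl
    refine congrArg (fun e => y.1 - ContinuousMap.const _ (y.1 1) - y.2 • primitive e) ?_
    ext s
    simp [augmentedCurve_apply, hgf]))
  rw [h4]
  have h5 : pointwiseApply MI p.1 = τ • pointwiseApply
      ((⟨fderiv ℝ f, hf.continuous_fderiv one_ne_zero⟩ : C(E, E →L[ℝ] E)).comp x) p.1 := by
    ext s
    simp [hMI]
  rw [h5, map_smul]
  refine Prod.ext ?_ rfl
  simp [sub_sub, add_comm (τ • _), add_assoc]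
  rfl

end PeriodicProblem

/-! ### The implicit function argument for the perturbed equation. -/

/-- The right-hand side of the perturbed Liénard system as a function of `(ε, s, x)`. -/
def perturbedField (ω : ℝ → ℝ → ℝ → ℝ) (p : ℝ × ℝ × ℝ × ℝ) : ℝ × ℝ :=
  lienardField p.2.2 + p.1 • ((ω p.2.1 p.2.2.2 p.2.2.1, 0) : ℝ × ℝ)

theorem contDiff_perturbedField {ω : ℝ → ℝ → ℝ → ℝ}
    (hω : ContDiff ℝ 1 (fun p : ℝ × ℝ × ℝ => ω p.1 p.2.1 p.2.2)) :
    ContDiff ℝ 1 (perturbedField ω) := by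
  have h1 : ContDiff ℝ 1 fun p : ℝ × ℝ × ℝ × ℝ => ω p.2.1 p.2.2.2 p.2.2.1 :=
    hω.comp (g := fun p : ℝ × ℝ × ℝ => ω p.1 p.2.1 p.2.2)
      (f := fun p : ℝ × ℝ × ℝ × ℝ => (p.2.1, p.2.2.2, p.2.2.1)) (by fun_prop)
  exact (contDiff_lienardField.comp (by fun_prop)).add
    (contDiff_fst.smul (h1.prodMk contDiff_const))

theorem theorem3
    (u₀ : ℝ → ℝ) (τ₀ a : ℝ)
    (hu₀ : IsLienardSolution (fun _ _ _ => 0) u₀)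
    (hτ₀ : IsLeast {T : ℝ | 0 < T ∧ Function.Periodic u₀ T} τ₀)
    (ha : a < 0) (hu₀a : u₀ 0 = a) (hu₀' : deriv u₀ 0 = 0)
    (hsimple : IsSimpleCharacteristicMultiplier lienardField (phaseCurve u₀) τ₀ 1)
    (ω : ℝ → ℝ → ℝ → ℝ)
    (hω : ContDiff ℝ 1 (fun p : ℝ × ℝ × ℝ => ω p.1 p.2.1 p.2.2))
    (hωper : ∀ s u v : ℝ, ω (s + 1) u v = ω s u v) :
    ∃ (U : Set (ℝ × ℝ)) (τ h : ℝ × ℝ → ℝ) (τ₁ : ℝ),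
      IsOpen U ∧ (0, 0) ∈ U ∧ τ₁ < τ₀ ∧
      ContDiffOn ℝ 1 τ U ∧ ContDiffOn ℝ 1 h U ∧
      τ (0, 0) = τ₀ ∧ h (0, 0) = 0 ∧
      ∀ ε α : ℝ, (ε, α) ∈ U →
        |τ (ε, α) - τ₀| < τ₁ ∧
        ∃ ν : ℝ → ℝ,
          IsLienardSolution (fun t u v => ε * ω (t / τ (ε, α)) u v) ν ∧
          ν α = a + h (ε, α) ∧ deriv ν α = 0 ∧
          Function.Periodic ν (τ (ε, α)) := by
  obtain ⟨Φ, ⟨hΦ0, hΦ⟩, hroot⟩ := hsimple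
  obtain ⟨⟨hτpos, hper⟩, -⟩ := hτ₀
  set q := phaseCurve u₀ with hq
  have hqd : ∀ t, HasDerivAt q (lienardField (q t)) t := fun t =>
    (hu₀.hasDerivAt_phaseCurve t).congr_deriv (by rw [Prod.mk_zero_zero, add_zero])
  have hqc : Continuous q := continuous_iff_continuousAt.2 fun t => (hqd t).continuousAt
  have hqper : Function.Periodic q τ₀ := periodic_phaseCurve hper
  have hq0 : q 0 = (0, a) := by simp [hq, phaseCurve, hu₀a, hu₀']
  have hqτ : q τ₀ = q 0 := by simpa using hqper 0
  have hfq0 : lienardField (q 0) = (-a, 0) := by simp [hq0, lienardField]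
  have hf : ContDiff ℝ 1 lienardField := contDiff_lienardField
  have hfc : Continuous (fderiv ℝ lienardField) := hf.continuous_fderiv one_ne_zero
  have hvel : ∀ t, HasDerivAt (fun t => lienardField (q t))
      (fderiv ℝ lienardField (q t) (lienardField (q t))) t := fun t =>
    (hf.differentiable one_ne_zero (q t)).hasFDerivAt.comp_hasDerivAt t (hqd t)
  have hlin : ∀ s : ℝ, HasDerivAt (fun s : ℝ => τ₀ * s) τ₀ s := fun s => by
    simpa using (hasDerivAt_id s).const_mul τ₀
  have hg := contDiff_perturbedField hω
  set x₀ : C(unitInterval, ℝ × ℝ) := ⟨fun s => q (τ₀ * s), by fun_prop⟩ with hx₀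
  have hx₀s : ∀ s : unitInterval, x₀ s = q (τ₀ * s) := fun _ => rfl
  set π := ContinuousLinearMap.fst ℝ ℝ ℝ
  set G := periodicDefect ⟨perturbedField ω, hg.continuous⟩ π with hG
  have hG0 : G ((0, 0), (x₀, τ₀)) = 0 := by
    refine Prod.ext ?_ ?_
    · ext1 s
      have h1 := primitive_eq_sub (w := fun s => q (τ₀ * s)) (y := τ₀ •
          (⟨perturbedField ω, hg.continuous⟩ : C(_, _)).comp (augmentedCurve ((0, 0), (x₀, τ₀))))
        (fun s => (hqd (τ₀ * s)).scomp s (hlin s))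
        ((hf.continuous.comp (hqc.comp (continuous_const_mul τ₀))).const_smul τ₀) (fun s => by
          simp [augmentedCurve_apply, perturbedField, hx₀s]) s
      have h2 : x₀ 1 = q 0 := by
        rw [hx₀s, ← hqτ]
        exact congrArg q (mul_one τ₀)
      rw [map_smul] at h1
      simp only [hG, periodicDefect, ContinuousMap.sub_apply, ContinuousMap.const_apply, h1, h2,
        hx₀s, mul_zero, sub_self, Prod.fst_zero, ContinuousMap.zero_apply]
    · change (x₀ 0).1 = 0
      rw [hx₀s]
      simp [hq0]
  have hGd : ContDiffAt ℝ 1 G ((0, 0), (x₀, τ₀)) := contDiffAt_periodicDefect hg π hτpos.ne'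
  have hinv : (fderiv ℝ G ((0, 0), (x₀, τ₀)) ∘L
      ContinuousLinearMap.inr ℝ (ℝ × ℝ) (C(unitInterval, ℝ × ℝ) × ℝ)).IsInvertible := by
    -- The velocity `f(q(t))` solves the variational equation and returns to its initial value after
    -- time `τ₀`.
    have hT : Φ τ₀ (-a, 0) = (-a, 0) := by
      have h1 := eq_fundamental_apply (hfc.comp hqc) hΦ0 hΦ hvel τ₀
      rw [hqτ, hfq0] at h1
      exact h1.symm
    have hbij := bijective_periodic_linearization
      (M := fun s => τ₀ • fderiv ℝ lienardField (q (τ₀ * s))) (Φ := fun s => Φ (τ₀ * s))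
      (v := fun s => lienardField (q (τ₀ * s)))
      (by fun_prop) (by simpa using hΦ0)
      (fun s => ((hΦ (τ₀ * s)).scomp s (hlin s)).congr_deriv (by simp))
      (fun s => (hvel (τ₀ * s)).scomp s (hlin s)) π
      (by
        simp only [mul_one, hqτ, hfq0]
        exact bijective_bordered_of_simple (neg_ne_zero.2 ha.ne) hT hroot)
      (MI := ⟨fun s => τ₀ • fderiv ℝ lienardField (q (τ₀ * s)), by fun_prop⟩) (fun s => rfl)
      (vI := (⟨lienardField, hf.continuous⟩ : C(_, _)).comp x₀) (fun s => rfl)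
    have hD := fun p => fderiv_periodicDefect_comp_inr hg hf
      (by simp [perturbedField]) π (x := x₀) hτpos.ne'
      (MI := ⟨fun s => τ₀ • fderiv ℝ lienardField (q (τ₀ * s)), by fun_prop⟩) (fun s => rfl) p
    rw [← funext hD] at hbij
    exact ⟨ContinuousLinearEquiv.ofBijective _ (LinearMap.ker_eq_bot.2 hbij.1)
      (LinearMap.range_eq_top.2 hbij.2), by ext <;> rfl⟩
  set ψ := hGd.implicitFunction one_ne_zero hinv
  have hψ0 : ψ (0, 0) = (x₀, τ₀) := hGd.implicitFunction_apply_self one_ne_zero hinv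
  have hψd : ContDiffAt ℝ 1 ψ (0, 0) := hGd.contDiffAt_implicitFunction one_ne_zero hinv
  have hψG : ∀ᶠ z in 𝓝 ((0, 0) : ℝ × ℝ), G (z, ψ z) = 0 := by
    have h1 := hGd.eventually_apply_implicitFunction one_ne_zero hinv
    rw [hG0] at h1
    exact h1
  -- The bound `τ₀ / 2` serves as `τ₁` and keeps the new period positive.
  have hψτ : ∀ᶠ z in 𝓝 ((0, 0) : ℝ × ℝ), |(ψ z).2 - τ₀| < τ₀ / 2 := by
    have h1 : ContinuousAt (fun z => |(ψ z).2 - τ₀|) (0, 0) :=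
      (hψd.continuousAt.snd.sub continuousAt_const).abs
    refine h1.eventually_lt continuousAt_const ?_
    simp [hψ0, hτpos]
  obtain ⟨U, hU, hUo, h0U⟩ := eventually_nhds_iff.1
    ((hψd.eventually (by simp)).and (hψG.and hψτ))
  refine ⟨U, fun z => (ψ z).2, fun z => ((ψ z).1 0).2 - a, τ₀ / 2, hUo, h0U, by linarith, ?_, ?_,
    by simp [hψ0], ?_, ?_⟩
  · exact fun z hz => (contDiffAt_snd.comp z (hU z hz).1).contDiffWithinAt
  · intro z hz
    have h1 : ContDiffAt ℝ 1 (fun z => ((ψ z).1 0).2) z :=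
      contDiffAt_snd.comp z ((ContinuousMap.evalCLM ℝ (0 : unitInterval) :
        C(unitInterval, ℝ × ℝ) →L[ℝ] ℝ × ℝ).contDiff.contDiffAt.comp z
          (contDiffAt_fst.comp z (hU z hz).1))
    exact (h1.sub contDiffAt_const).contDiffWithinAt
  · simp [hψ0, hx₀s, hq0]
  · intro ε α hεα
    obtain ⟨-, hzero, hτ⟩ := hU _ hεα
    refine ⟨hτ, ?_⟩
    set x := (ψ (ε, α)).1 with hx
    set τ := (ψ (ε, α)).2 with hτdef
    have hτpos' : 0 < τ := by linarith [(abs_lt.1 hτ).1]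
    obtain ⟨hz1, hz2⟩ := Prod.mk.injEq _ _ _ _ ▸ (hzero : (_, _) = ((0 : C(_, _)), (0 : ℝ)))
    obtain ⟨X, hXper, hX0, hXd⟩ := exists_periodic_solution
      (F := fun s v => perturbedField ω (ε, α / τ + s, v)) (τ := τ) (x := x)
      (hg.continuous.comp (by fun_prop))
      (fun s v => by simp only [perturbedField, ← add_assoc, hωper])
      (fun s => by
        have h1 := congrArg (fun y : C(unitInterval, ℝ × ℝ) => y s) hz1
        simp only [ContinuousMap.sub_apply, ContinuousMap.const_apply, ContinuousMap.smul_apply,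
          ContinuousMap.zero_apply, primitive_apply] at h1
        rw [sub_eq_zero, sub_eq_iff_eq_add'] at h1
        refine h1.trans (congrArg (fun e => x 1 + τ • e)
          (intervalIntegral.integral_congr fun r hr => ?_))
        rw [uIcc_of_le s.2.1] at hr
        have hr' : r ∈ Icc (0 : ℝ) 1 := ⟨hr.1, hr.2.trans s.2.2⟩
        have h2 := extendUnit_coe ((⟨perturbedField ω, hg.continuous⟩ : C(_, _)).comp
          (augmentedCurve ((ε, α), ψ (ε, α)))) ⟨r, hr'⟩
        have h3 := extendUnit_coe x ⟨r, hr'⟩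
        refine h2.trans ?_
        simp only [ContinuousMap.comp_apply, augmentedCurve_apply, ContinuousMap.coe_mk]
        rw [← hx, ← h3])
    obtain ⟨hsol, hder⟩ := isLienardSolution_of_hasDerivAt
      (p := fun t u v => ε * ω (t / τ) u v) (α := α) hτpos'.ne' (X := X) (fun s => by
        refine (hXd s).congr_deriv ?_
        -- The shift `α / τ` in the forcing matches the starting time `α`.
        have h1 : (α + τ * s) / τ = α / τ + s := by field_simp
        simp [perturbedField, h1])
    refine ⟨_, hsol, ?_, ?_, fun t => ?_⟩
    · simp [hX0, hx]
    · rw [hder]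
      simp only [sub_self, zero_div, hX0]
      exact hz2
    · have h1 : (t + τ - α) / τ = (t - α) / τ + 1 := by field_simp; ring
      change (X ((t + τ - α) / τ)).2 = (X ((t - α) / τ)).2
      rw [h1, hXper]
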